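/- Let $0<\underline\rho\le\overline\rho$, $0<\underline\sigma\le\overline\sigma$, and $\alpha,\beta,\gamma>0$ with $\gamma\ge 2\beta$. Put $$c_1=\max\{\alpha\overline\rho,\alpha\gamma\overline\sigma\}\max\{2,\tfrac{\overline\sigma}{\underline\sigma}\},\qquad c_2=2\beta\tfrac{\overline\sigma}{\underline\sigma}\max\{2,\tfrac{\overline\sigma}{\underline\sigma}\},$$ $$c_3=\tfrac{\beta\overline\sigma}{\underline\rho}\max\{2,\tfrac{2}{\alpha\gamma\underline\sigma},\tfrac{\overline\sigma}{\alpha\gamma\underline\sigma^2}\},\qquad c_4=\tfrac{2\beta\overline\sigma^2}{\gamma\underline\sigma^2}\max\{\tfrac{\overline\sigma}{\underline\sigma},\alpha\gamma\overline\sigma\},$$ and assume $\max\{c_1,c_2,c_3,c_4\}\in[0,\tfrac14]$. Let $c=4\max\{c_1,c_2,c_3,c_4\}$ and $\tau=\sqrt{1-\tfrac{1-c}{c}\alpha\beta\underline\sigma}$. Then $c>0$, $0<\tau\le1$, and $\tau<1$ if $c<1$. Moreover there are constants $C_1,C_2>0$, depending only on $\underline\rho,\overline\rho,\underline\sigma,\overline\sigma,\alpha,\beta,\gamma$,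 such that the following holds for all $n,p$, all $b\in\mathbb R^p$, every twice differentiable $f:\mathbb R^n\to\mathbb R$ that is $\underline\rho$-strongly convex with $\overline\rho$-Lipschitz gradient, and every $A\in\mathbb R^{p\times n}$ with rows $a_1,\dots,a_p$ and $\underline\sigma I\le AA^{\top}\le\overline\sigma I$ (so $A$ has full row rank). For the problem $\min f(x)$ subject to $Ax\le b$, let $\mathcal L(x,\lambda)=f(x)+\sum_{i=1}^p\varphi_\gamma(a_ix-b_i,\lambda_i)$, where $\varphi_\gamma(u,l)=ul+\tfrac\gamma2u^2$ if $\gamma u+l\ge0$ and $\varphi_\gamma(u,l)=-\tfrac{l^2}{2\gamma}$ otherwise, and consider the primal–dual iteration $$x^{k+1}=x^k-\alpha\nabla f(x^k)-\alpha\sum_{i=1}^p\max\{\gamma(a_ix^k-b_i)+\lambda_i^k,0\}\,a_i^{\top},$$ $$\lambda_i^{k+1}=\lambda_i^k+\tfrac\beta\gamma\bigl(\max\{\gamma(a_ix^k-b_i)+\lambda_i^k,0\}-\lambda_i^k\bigr),\qquad i=1,\dots,p.$$ The matrix $M=\begin{bmatrix}\beta cI&\alpha\beta A^{\top}\\ \alpha\beta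 A&\alpha cI\end{bmatrix}$ is positive definite. Let $d_M$ be the Riemannian distance on $\mathbb R^{n+p}$ of the constant metric $M$, that is, the infimum of $\int_0^1\sqrt{\dot\varrho(s)^{\top}M\dot\varrho(s)}\,ds$ over the piecewise smooth paths $\varrho$ that join the two points. Then: 1. One step of the iteration, applied to any two states $\xi,\eta\in\mathbb R^{n+p}$, yields states $\xi^+,\eta^+$ with $d_M(\xi^+,\eta^+)\le\tau\,d_M(\xi,\eta)$. 2. For every trajectory $(x^k,\lambda^k)$ of the iteration, every pair $(x^*,\lambda^*)$ with $\nabla_x\mathcal L(x^*,\lambda^*)=0$ and $\nabla_\lambda\mathcal L(x^*,\lambda^*)=0$, and every $k\ge0$, $$d_M\bigl((x^k,\lambda^k),(x^*,\lambda^*)\bigr)\le\tau^k\,d_M\bigl((x^0,\lambda^0),(x^*,\lambda^*)\bigr),$$ $$\|x^k-x^*\|\le C_1\tau^k\bigl(\|x^0-x^*\|+\|\lambda^0-\lambda^*\|\bigr),\qquad \|\lambda^k-\lambda^*\|\le C_2\tau^k\bigl(\|x^0-x^*\|+\|\lambda^0-\lambda^*\|\bigr).$$ -/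

import Mathlib

/-! ### Riemannian distance for a constant metric -/

/-- Piecewise smooth path on `[0, 1]` from `ξ` to `η`: there is a partition
`0 = t 0 ≤ t 1 ≤ ... ≤ t m = 1` such that `ϱ` is smooth on each closed piece. -/
def IsPiecewiseSmoothPath {ι : Type*} [Fintype ι]
    (ϱ : ℝ → EuclideanSpace ℝ ι) (ξ η : EuclideanSpace ℝ ι) : Prop :=
  ϱ 0 = ξ ∧ ϱ 1 = η ∧ ∃ (m : ℕ) (t : ℕ → ℝ), Monotone t ∧ t 0 = 0 ∧ t m = 1 ∧
    ∀ i < m, ContDiffOn ℝ ((⊤ : ℕ∞) : WithTop ℕ∞) ϱ (Set.Icc (t i) (t (i + 1)))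

/-- Length of a path in the constant metric `M`: the integral over `[0, 1]` of
`√(ϱ'(s)ᵀ M ϱ'(s))`. -/
noncomputable def riemLength {ι : Type*} [Fintype ι] (M : Matrix ι ι ℝ)
    (ϱ : ℝ → EuclideanSpace ℝ ι) : ℝ :=
  ∫ s in (0 : ℝ)..1, √((deriv ϱ s).ofLp ⬝ᵥ (M.mulVec (deriv ϱ s).ofLp))

/-- Riemannian distance: infimum of the lengths of the piecewise smooth paths. -/
noncomputable def riemDist {ι : Type*} [Fintype ι] (M : Matrix ι ι ℝ)
    (ξ η : EuclideanSpace ℝ ι) : ℝ :=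
  sInf {L : ℝ | ∃ ϱ : ℝ → EuclideanSpace ℝ ι,
    IsPiecewiseSmoothPath ϱ ξ η ∧ L = riemLength M ϱ}

/-! ### The assumptions on the problem -/

/-- `f` is twice differentiable, `ρl`-strongly convex, with `ρu`-Lipschitz gradient. -/
structure IsStronglyConvexSmooth {n : ℕ} (f : EuclideanSpace ℝ (Fin n) → ℝ)
    (ρl ρu : ℝ) : Prop where
  differentiable : Differentiable ℝ f
  differentiable_gradient : Differentiable ℝ (gradient f)
  strong : ∀ x y, ρl * ‖x - y‖ ^ 2 ≤ inner ℝ (gradient f x - gradient f y) (x - y)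
  lipschitz : ∀ x y, ‖gradient f x - gradient f y‖ ≤ ρu * ‖x - y‖

/-- `σl I ≤ A Aᵀ ≤ σu I` in the Loewner order. For `0 < σl` this contains the full row rank
of `A`. -/
structure IsRowBounded {n p : ℕ} (A : Matrix (Fin p) (Fin n) ℝ) (σl σu : ℝ) : Prop where
  lower : (A * A.transpose - σl • (1 : Matrix (Fin p) (Fin p) ℝ)).PosSemidef
  upper : (σu • (1 : Matrix (Fin p) (Fin p) ℝ) - A * A.transpose).PosSemidef

/-! ### Augmented Lagrangian, optimal pairs, and the primal-dual iteration -/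

/-- The scalar penalty function. -/
noncomputable def penalty (γ u l : ℝ) : ℝ :=
  if 0 ≤ γ * u + l then u * l + γ / 2 * u ^ 2 else -(l ^ 2 / (2 * γ))

/-- The augmented Lagrangian of `min f x` subject to `A x ≤ b`. -/
noncomputable def augLagrangian {n p : ℕ} (f : EuclideanSpace ℝ (Fin n) → ℝ)
    (A : Matrix (Fin p) (Fin n) ℝ) (b : Fin p → ℝ) (γ : ℝ)
    (x : EuclideanSpace ℝ (Fin n)) (l : EuclideanSpace ℝ (Fin p)) : ℝ :=
  f x + ∑ i, penalty γ (A.mulVec x.ofLp i - b i) (l i)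

/-- The optimal pairs: both partial gradients of the augmented Lagrangian vanish. -/
def IsKKTPair {n p : ℕ} (f : EuclideanSpace ℝ (Fin n) → ℝ)
    (A : Matrix (Fin p) (Fin n) ℝ) (b : Fin p → ℝ) (γ : ℝ)
    (x : EuclideanSpace ℝ (Fin n)) (l : EuclideanSpace ℝ (Fin p)) : Prop :=
  gradient (fun y => augLagrangian f A b γ y l) x = 0 ∧
    gradient (fun m => augLagrangian f A b γ x m) l = 0

/-- Primal update. -/
noncomputable def primalStep {n p : ℕ} (f : EuclideanSpace ℝ (Fin n) → ℝ)
    (A : Matrix (Fin p) (Fin n) ℝ) (b : Fin p → ℝ) (α γ : ℝ)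
    (x : EuclideanSpace ℝ (Fin n)) (l : EuclideanSpace ℝ (Fin p)) :
    EuclideanSpace ℝ (Fin n) :=
  x - α • gradient f x
    - α • ∑ i, max (γ * (A.mulVec x.ofLp i - b i) + l i) 0 • WithLp.toLp 2 (A i)

/-- Dual update. -/
noncomputable def dualStep {n p : ℕ}
    (A : Matrix (Fin p) (Fin n) ℝ) (b : Fin p → ℝ) (β γ : ℝ)
    (x : EuclideanSpace ℝ (Fin n)) (l : EuclideanSpace ℝ (Fin p)) :
    EuclideanSpace ℝ (Fin p) :=
  l + β • ∑ i, (1 / γ * (max (γ * (A.mulVec x.ofLp i - b i) + l i) 0 - l i)) •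
    EuclideanSpace.single i (1 : ℝ)

/-- The stacked vector `(x, l)`. -/
def stack {n p : ℕ} (x : EuclideanSpace ℝ (Fin n)) (l : EuclideanSpace ℝ (Fin p)) :
    EuclideanSpace ℝ (Fin n ⊕ Fin p) :=
  WithLp.toLp 2 (Sum.elim x.ofLp l.ofLp)

/-! ### The constants, the metric, the rate -/

noncomputable def const1 (ρu σl σu α γ : ℝ) : ℝ :=
  max (α * ρu) (α * γ * σu) * max 2 (σu / σl)

noncomputable def const2 (σl σu β : ℝ) : ℝ :=
  2 * β * (σu / σl) * max 2 (σu / σl)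

noncomputable def const3 (ρl σl σu α β γ : ℝ) : ℝ :=
  β * σu / ρl * max 2 (max (2 / (α * γ * σl)) (σu / (α * γ * σl ^ 2)))

noncomputable def const4 (σl σu α β γ : ℝ) : ℝ :=
  2 * (β * σu ^ 2 / (γ * σl ^ 2)) * max (σu / σl) (α * γ * σu)

/-- The largest of the four constants. -/
noncomputable def constMax (ρl ρu σl σu α β γ : ℝ) : ℝ :=
  max (max (const1 ρu σl σu α γ) (const2 σl σu β))
    (max (const3 ρl σl σu α β γ) (const4 σl σu α β γ))

/-- The metric `[[β c I, α β Aᵀ], [α β A, α c I]]`. -/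
def metricM {n p : ℕ} (A : Matrix (Fin p) (Fin n) ℝ) (α β c : ℝ) :
    Matrix (Fin n ⊕ Fin p) (Fin n ⊕ Fin p) ℝ :=
  Matrix.fromBlocks ((β * c) • 1) ((α * β) • A.transpose) ((α * β) • A) ((α * c) • 1)

/-- The convergence rate. -/
noncomputable def rateIEC (σl α β c : ℝ) : ℝ :=
  √(1 - (1 - c) / c * α * β * σl)

open scoped InnerProductSpace

/-! For the constant metric `M` straight lines are shortest, so the distance is the norm of the
difference (`riemDist_eq_metricNorm`), and contraction becomes an inequality for the quadratic form
`metricForm`. The update is not differentiated. Between two states each difference of `max · 0` is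
`δ i` times the difference of arguments with `0 ≤ δ i ≤ 1` (`exists_max_zero_sub_eq`), and the
gradient difference is controlled by strong monotonicity and cocoercivity. This leaves the algebraic
inequality `metricForm_step_le`.

There the diagonal blocks of `M` give the dissipation `-2 * c * D`, `D = X + γ * R + Q / γ`, since
the skew primal-dual coupling cancels. `D` need not control the multiplier in constraints with `δ i
= 1`. The off-diagonal blocks repair this: they produce `-2 * α * ‖S l‖ ^ 2`, with `S` the transpose
of `A`, and `σl * ‖l‖ ^ 2 ≤ ‖S l‖ ^ 2`. Small step sizes (`constMax_bounds`) let these two terms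
absorb all the others.

Optimal pairs are fixed points, so trajectories converge to them by iteration. The off-diagonal part
of `M` is at most half of the diagonal part, which turns the rate in `M` into rates for `x` and `l`.
-/

/-! ### ### Convexity, descent and cocoercivity of the gradient -/

/-- A function with strongly monotone gradient lies above its tangents. -/
theorem IsStronglyConvexSmooth.le_add_inner {n : ℕ} {f : EuclideanSpace ℝ (Fin n) → ℝ}
    {ρl ρu : ℝ} (hf : IsStronglyConvexSmooth f ρl ρu) (hρl : 0 < ρl)
    (x v : EuclideanSpace ℝ (Fin n)) :
    f x + ⟪gradient f x, v⟫_ℝ ≤ f (x + v) := by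
  -- Along the segment, `f` minus its tangent at `x` has nonnegative derivative by monotonicity of
  -- the gradient.
  have hd : ∀ t : ℝ, HasDerivAt (fun t : ℝ => f (x + t • v) - t * ⟪gradient f x, v⟫_ℝ)
      (⟪gradient f (x + t • v), v⟫_ℝ - ⟪gradient f x, v⟫_ℝ) t := by
    intro t
    have h1 : HasDerivAt (fun t : ℝ => x + t • v) v t := by
      simpa using ((hasDerivAt_id t).smul_const v).const_add x
    have h2 := (hf.differentiable (x + t • v)).hasGradientAt.hasFDerivAt.comp_hasDerivAt t h1
    have h3 := h2.sub ((hasDerivAt_id t).mul_const ⟪gradient f x, v⟫_ℝ)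
    exact h3.congr_deriv (by simp)
  have hm : MonotoneOn (fun t : ℝ => f (x + t • v) - t * ⟪gradient f x, v⟫_ℝ) (Set.Icc 0 1) := by
    refine monotoneOn_of_deriv_nonneg (convex_Icc 0 1)
      (fun t _ => (hd t).continuousAt.continuousWithinAt)
      (fun t _ => (hd t).differentiableAt.differentiableWithinAt) fun t ht => ?_
    rw [interior_Icc] at ht
    rw [(hd t).deriv]
    have := hf.strong (x + t • v) x
    rw [add_sub_cancel_left, inner_smul_right, inner_sub_left] at this
    have h0 : 0 ≤ t * (⟪gradient f (x + t • v), v⟫_ℝ - ⟪gradient f x, v⟫_ℝ) :=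
      le_trans (by positivity) this
    exact nonneg_of_mul_nonneg_right h0 ht.1
  have := hm (by simp) (by simp) (zero_le_one' ℝ)
  simp only [zero_smul, one_smul, add_zero] at this
  linarith

/-- Descent lemma for a Lipschitz gradient. -/
theorem IsStronglyConvexSmooth.le_descent {n : ℕ} {f : EuclideanSpace ℝ (Fin n) → ℝ}
    {ρl ρu : ℝ} (hf : IsStronglyConvexSmooth f ρl ρu)
    (x v : EuclideanSpace ℝ (Fin n)) :
    f (x + v) ≤ f x + ⟪gradient f x, v⟫_ℝ + ρu / 2 * ‖v‖ ^ 2 := by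
  have hd : ∀ t : ℝ, HasDerivAt
      (fun t : ℝ => f (x + t • v) - t * ⟪gradient f x, v⟫_ℝ - t ^ 2 * (ρu / 2 * ‖v‖ ^ 2))
      (⟪gradient f (x + t • v), v⟫_ℝ - ⟪gradient f x, v⟫_ℝ - 2 * t * (ρu / 2 * ‖v‖ ^ 2)) t := by
    intro t
    have h1 : HasDerivAt (fun t : ℝ => x + t • v) v t := by
      simpa using ((hasDerivAt_id t).smul_const v).const_add x
    have h2 := (hf.differentiable (x + t • v)).hasGradientAt.hasFDerivAt.comp_hasDerivAt t h1
    have h3 := (h2.sub ((hasDerivAt_id t).mul_const ⟪gradient f x, v⟫_ℝ)).sub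
      ((hasDerivAt_pow 2 t).mul_const (ρu / 2 * ‖v‖ ^ 2))
    exact h3.congr_deriv (by simp)
  have hm : AntitoneOn (fun t : ℝ => f (x + t • v) - t * ⟪gradient f x, v⟫_ℝ -
      t ^ 2 * (ρu / 2 * ‖v‖ ^ 2)) (Set.Icc 0 1) := by
    refine antitoneOn_of_deriv_nonpos (convex_Icc 0 1)
      (fun t _ => (hd t).continuousAt.continuousWithinAt)
      (fun t _ => (hd t).differentiableAt.differentiableWithinAt) fun t ht => ?_
    rw [interior_Icc] at ht
    rw [(hd t).deriv]
    have h1 := hf.lipschitz (x + t • v) x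
    rw [add_sub_cancel_left, norm_smul, Real.norm_of_nonneg ht.1.le] at h1
    have h2 := real_inner_le_norm (gradient f (x + t • v) - gradient f x) v
    rw [inner_sub_left] at h2
    nlinarith [mul_le_mul_of_nonneg_right h1 (norm_nonneg v)]
  have := hm (by simp) (by simp) (zero_le_one' ℝ)
  simp only [zero_smul, one_smul, add_zero] at this
  linarith

/-- Baillon–Haddad: the gradient is cocoercive. -/
theorem IsStronglyConvexSmooth.cocoercive {n : ℕ} {f : EuclideanSpace ℝ (Fin n) → ℝ}
    {ρl ρu : ℝ} (hf : IsStronglyConvexSmooth f ρl ρu) (hρl : 0 < ρl) (hρu : 0 < ρu)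
    (x y : EuclideanSpace ℝ (Fin n)) :
    ‖gradient f x - gradient f y‖ ^ 2 ≤ ρu * ⟪gradient f x - gradient f y, x - y⟫_ℝ := by
  have key : ∀ x y : EuclideanSpace ℝ (Fin n),
      ‖gradient f x - gradient f y‖ ^ 2 ≤
        2 * ρu * (f x - f y - ⟪gradient f y, x - y⟫_ℝ) := by
    intro x y
    set d := gradient f x - gradient f y with hd
    -- A step `1 / ρu` along `-d` from `x` is evaluated twice: descent from `x` bounds `f` above
    -- there, the tangent at `y` bounds it below. This step length minimizes the quadratic upper
    -- bound for `f` minus its tangent at `y`. Adding the result to its mirror image in `x`, `y`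
    -- cancels the function values.
    have h1 := hf.le_descent x (-(1 / ρu) • d)
    have h2 := hf.le_add_inner hρl y (x - y + -(1 / ρu) • d)
    have e : y + (x - y + -(1 / ρu) • d) = x + -(1 / ρu) • d := by abel
    rw [e, inner_add_right, inner_smul_right] at h2
    rw [inner_smul_right, norm_smul, Real.norm_eq_abs, mul_pow, sq_abs] at h1
    have h3 : ⟪gradient f x, d⟫_ℝ - ⟪gradient f y, d⟫_ℝ = ‖d‖ ^ 2 := by
      rw [← inner_sub_left, ← hd, real_inner_self_eq_norm_sq]
    have h4 : ⟪gradient f x, d⟫_ℝ = ⟪gradient f y, d⟫_ℝ + ‖d‖ ^ 2 := by linarith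
    rw [h4] at h1
    have h5 : ‖d‖ ^ 2 / (2 * ρu) ≤ f x - f y - ⟪gradient f y, x - y⟫_ℝ := by
      have e1 : ‖d‖ ^ 2 / (2 * ρu) =
          (1 / ρu) * ‖d‖ ^ 2 - ρu / 2 * ((-(1 / ρu)) ^ 2 * ‖d‖ ^ 2) := by
        field_simp; ring
      rw [e1]; linarith
    rw [div_le_iff₀ (by positivity)] at h5
    linarith
  have h1 := key x y
  have h2 := key y x
  rw [norm_sub_rev] at h2
  have h3 : ⟪gradient f x - gradient f y, x - y⟫_ℝ =
      - ⟪gradient f y, x - y⟫_ℝ - ⟪gradient f x, y - x⟫_ℝ := by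
    rw [inner_sub_left, ← neg_sub x y, inner_neg_right]; ring
  rw [h3]; linarith

/-! ### ### Contraction of the quadratic form -/

section Contraction

variable {E F : Type*} [NormedAddCommGroup E] [InnerProductSpace ℝ E]
  [NormedAddCommGroup F] [InnerProductSpace ℝ F]

/-- The quadratic form of the metric `[[β c I, α β Aᵀ], [α β A, α c I]]`. -/
noncomputable def metricForm (T : E →ₗ[ℝ] F) (α β c : ℝ) (x : E) (l : F) : ℝ :=
  β * c * ‖x‖ ^ 2 + 2 * (α * β) * ⟪l, T x⟫_ℝ + α * c * ‖l‖ ^ 2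

theorem two_inner_le (a b : E) {ε : ℝ} (hε : 0 < ε) :
    2 * ⟪a, b⟫_ℝ ≤ ε * ‖a‖ ^ 2 + ε⁻¹ * ‖b‖ ^ 2 := by
  have h := real_inner_le_norm a b
  have h2 : 0 ≤ ε⁻¹ * (ε * ‖a‖ - ‖b‖) ^ 2 := by positivity
  have e : ε⁻¹ * (ε * ‖a‖ - ‖b‖) ^ 2 = ε * ‖a‖ ^ 2 + ε⁻¹ * ‖b‖ ^ 2 - 2 * (‖a‖ * ‖b‖) := by
    field_simp; ring
  linarith

/-- An operator and its adjoint have the same norm: `‖T x‖ ^ 2 = ⟪S (T x), x⟫`, then Cauchy–Schwarz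
and division by `‖T x‖ ^ 2` when it is nonzero. -/
theorem norm_sq_le_of_adjoint {T : E →ₗ[ℝ] F} {S : F →ₗ[ℝ] E} {σu : ℝ} (hσu : 0 ≤ σu)
    (hST : ∀ x l, ⟪l, T x⟫_ℝ = ⟪S l, x⟫_ℝ) (hSu : ∀ l, ‖S l‖ ^ 2 ≤ σu * ‖l‖ ^ 2) (x : E) :
    ‖T x‖ ^ 2 ≤ σu * ‖x‖ ^ 2 := by
  have h1 : ‖T x‖ ^ 2 = ⟪S (T x), x⟫_ℝ := by rw [← hST, real_inner_self_eq_norm_sq]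
  have h2 := real_inner_le_norm (S (T x)) x
  have h3 := hSu (T x)
  have h4 : (‖T x‖ ^ 2) ^ 2 ≤ (σu * ‖x‖ ^ 2) * ‖T x‖ ^ 2 := by
    calc (‖T x‖ ^ 2) ^ 2 ≤ (‖S (T x)‖ * ‖x‖) ^ 2 := by
          gcongr; linarith
      _ = ‖S (T x)‖ ^ 2 * ‖x‖ ^ 2 := by ring
      _ ≤ (σu * ‖T x‖ ^ 2) * ‖x‖ ^ 2 := by gcongr
      _ = _ := by ring
  rcases eq_or_lt_of_le (sq_nonneg ‖T x‖) with h | h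
  · rw [← h]; positivity
  · rw [pow_two] at h4
    exact le_of_mul_le_mul_right h4 h

set_option maxHeartbeats 1000000 in
/-- One step of the linearized primal-dual iteration contracts the metric form. Here `d` is the
increment of the gradient, `r = Δ A x` and `q = (1 - Δ) l` for a diagonal `0 ≤ Δ ≤ 1`. -/
theorem metricForm_step_le {T : E →ₗ[ℝ] F} {S : F →ₗ[ℝ] E}
    {ρl ρu σl σu α β γ c : ℝ} (hρl : 0 < ρl) (hρ : ρl ≤ ρu) (hσl : 0 < σl) (hσ : σl ≤ σu)
    (hα : 0 < α) (hβ : 0 < β) (hγ : 0 < γ) (hγβ : 2 * β ≤ γ) (hc : 0 < c) (hc1 : c ≤ 1)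
    (h1 : 8 * (α * ρu) ≤ c) (h2 : 8 * (α * γ * σu) ≤ c)
    (h4 : 64 * (β * σu) ≤ c ^ 2 * ρl) (h5 : 512 * (α * β * σu) ≤ c ^ 3)
    (hST : ∀ x l, ⟪l, T x⟫_ℝ = ⟪S l, x⟫_ℝ) (hSl : ∀ l, σl * ‖l‖ ^ 2 ≤ ‖S l‖ ^ 2)
    (hSu : ∀ l, ‖S l‖ ^ 2 ≤ σu * ‖l‖ ^ 2)
    (x d : E) (l r q : F)
    (hX : ρl * ‖x‖ ^ 2 ≤ ⟪d, x⟫_ℝ) (hd : ‖d‖ ^ 2 ≤ ρu * ⟪d, x⟫_ℝ)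
    (hr : ‖r‖ ^ 2 ≤ ⟪r, T x⟫_ℝ) (hq : ‖q‖ ^ 2 ≤ ⟪q, l⟫_ℝ)
    (hrq : ⟪r, l⟫_ℝ = ⟪l, T x⟫_ℝ - ⟪q, T x⟫_ℝ) :
    metricForm T α β c (x - α • (d + S (γ • r + l - q))) (l + β • (r - γ⁻¹ • q)) ≤
      (1 - (1 - c) / c * α * β * σl) * metricForm T α β c x l := by
  set X := ⟪d, x⟫_ℝ with hXdef
  set R := ⟪r, T x⟫_ℝ with hRdef
  set Q := ⟪q, l⟫_ℝ with hQdef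
  set D := X + γ * R + Q / γ with hD
  set e := d + γ • S r - S q with he
  set h := r - γ⁻¹ • q with hh
  set P := S l with hP
  have hσu : 0 < σu := hσl.trans_le hσ
  have hρu : 0 < ρu := hρl.trans_le hρ
  have hX0 : 0 ≤ X := le_trans (by positivity) hX
  have hR0 : 0 ≤ R := le_trans (by positivity) hr
  have hQ0 : 0 ≤ Q := le_trans (by positivity) hq
  have hQγ : 0 ≤ Q / γ := by positivity
  have hXD : X ≤ D := by have : 0 ≤ γ * R := by positivity
                         linarith
  have hD0 : 0 ≤ D := hX0.trans hXD
  have hg : d + S (γ • r + l - q) = P + e := by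
    rw [map_sub, map_add, map_smul, hP, he]; abel
  have hy := norm_sq_le_of_adjoint hσu.le hST hSu x
  -- the pieces of the increment
  have hxg : ⟪P + e, x⟫_ℝ - ⟪l, h⟫_ℝ = D := by
    rw [← hg, inner_add_left, ← hST, inner_sub_left, inner_add_left, inner_smul_left, hh,
      inner_sub_right, inner_smul_right, real_inner_comm r l, hrq, real_inner_comm q l, ← hQdef, ← hRdef, ← hXdef, hD]
    simp only [conj_trivial]
    ring
  -- The diagonal blocks contribute `-2 * c * D` through `hxg`; the cross block contributes `-2 * α
  -- * ⟪P, P + e⟫`, the source of decay in `l`.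
  have hinc : metricForm T α β c (x - α • (P + e)) (l + β • h) - metricForm T α β c x l =
      α * β * (-2 * c * D + c * α * ‖P + e‖ ^ 2 - 2 * α * ⟪P, P + e⟫_ℝ + 2 * β * ⟪h, T x⟫_ℝ
        - 2 * α * β * ⟪S h, P + e⟫_ℝ + c * β * ‖h‖ ^ 2) := by
    simp only [metricForm]
    rw [norm_sub_sq_real, norm_add_sq_real l, map_sub, map_smul, norm_smul, norm_smul,
      Real.norm_of_nonneg hα.le, Real.norm_of_nonneg hβ.le, ← hxg, inner_smul_right x,
      inner_smul_right l, inner_sub_right, inner_add_left l, inner_add_left l, inner_smul_left,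
      inner_smul_right, inner_smul_left, inner_smul_right, hST (P + e) l, hST (P + e) h,
      real_inner_comm x (P + e), ← hP]
    simp
    ring
  -- bounds
  have he2 : α * ‖e‖ ^ 2 ≤ 3 / 8 * (c * D) := by
    have a1 : ‖e‖ ^ 2 ≤ 3 * (‖d‖ ^ 2 + ‖γ • S r‖ ^ 2 + ‖S q‖ ^ 2) := by
      have t1 : ‖e‖ ≤ ‖d‖ + ‖γ • S r‖ + ‖S q‖ :=
        (norm_sub_le _ _).trans (by gcongr; exact norm_add_le _ _)
      calc ‖e‖ ^ 2 ≤ (‖d‖ + ‖γ • S r‖ + ‖S q‖) ^ 2 := by gcongr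
        _ ≤ _ := by
          nlinarith [sq_nonneg (‖d‖ - ‖γ • S r‖), sq_nonneg (‖d‖ - ‖S q‖),
            sq_nonneg (‖γ • S r‖ - ‖S q‖)]
    have a2 : ‖γ • S r‖ ^ 2 ≤ γ ^ 2 * (σu * R) := by
      rw [norm_smul, Real.norm_of_nonneg hγ.le, mul_pow]
      gcongr
      exact (hSu r).trans (by gcongr)
    have a3 : ‖S q‖ ^ 2 ≤ σu * Q := (hSu q).trans (by gcongr)
    have a4 : 8 * (α * ρu) * X ≤ c * X := by gcongr
    have a5 : 8 * (α * γ * σu) * (γ * R) ≤ c * (γ * R) := by gcongr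
    have a6 : 8 * (α * γ * σu) * (Q / γ) ≤ c * (Q / γ) := by gcongr
    have a7 : α * γ * σu * (Q / γ) = α * (σu * Q) := by field_simp
    have a8 : α * ‖e‖ ^ 2 ≤ α * (3 * (ρu * X + γ ^ 2 * (σu * R) + σu * Q)) := by
      gcongr
      exact a1.trans (by gcongr)
    rw [hD]
    linarith
  -- The condition `2 * β ≤ γ` enters here: it absorbs the factor 2 from squaring a sum of two
  -- terms.
  have hh2 : β * ‖h‖ ^ 2 ≤ D := by
    have a1 : ‖h‖ ^ 2 ≤ 2 * (‖r‖ ^ 2 + ‖γ⁻¹ • q‖ ^ 2) := by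
      calc ‖h‖ ^ 2 ≤ (‖r‖ + ‖γ⁻¹ • q‖) ^ 2 := by gcongr; exact norm_sub_le _ _
        _ ≤ _ := by nlinarith [sq_nonneg (‖r‖ - ‖γ⁻¹ • q‖)]
    have a2 : ‖γ⁻¹ • q‖ ^ 2 ≤ γ⁻¹ ^ 2 * Q := by
      rw [norm_smul, Real.norm_of_nonneg (by positivity), mul_pow]
      gcongr
    have a3 : γ * (γ⁻¹ ^ 2 * Q) = Q / γ := by field_simp
    calc β * ‖h‖ ^ 2 ≤ β * (2 * (R + γ⁻¹ ^ 2 * Q)) := by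
          gcongr
          exact a1.trans (by gcongr)
      _ = (2 * β) * (R + γ⁻¹ ^ 2 * Q) := by ring
      _ ≤ γ * (R + γ⁻¹ ^ 2 * Q) := by gcongr
      _ ≤ D := by rw [mul_add, a3, hD]; linarith
  have hx2 : 64 * (β * σu) * ‖x‖ ^ 2 ≤ c ^ 2 * X := by
    calc 64 * (β * σu) * ‖x‖ ^ 2 ≤ c ^ 2 * ρl * ‖x‖ ^ 2 := by gcongr
      _ = c ^ 2 * (ρl * ‖x‖ ^ 2) := by ring
      _ ≤ _ := by gcongr
  have hyX : 64 * (β * ‖T x‖ ^ 2) ≤ c ^ 2 * X := by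
    refine le_trans ?_ hx2
    have : β * ‖T x‖ ^ 2 ≤ β * (σu * ‖x‖ ^ 2) := by gcongr
    linarith
  have hc2 : c ^ 2 * X ≤ c * D := by
    have : c ^ 2 ≤ c := by nlinarith
    calc c ^ 2 * X ≤ c * X := by gcongr
      _ ≤ _ := by gcongr
  have hcD0 : 0 ≤ c * D := by positivity
  -- The mixed term is `-2 * (1 - c) * α * ⟪P, e⟫`. Young's weight `4 / 5` leaves a coefficient of
  -- `α * ‖P‖ ^ 2` exceeding the `1 - c` needed for the rate by enough to pay for `b3` and `b5`.
  have b1 : c * α * ‖P + e‖ ^ 2 - 2 * α * ⟪P, P + e⟫_ℝ ≤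
      -(6 / 5 - c / 5) * α * ‖P‖ ^ 2 + 5 / 4 * (α * ‖e‖ ^ 2) := by
    have y1 := two_inner_le P (-e) (show (0 : ℝ) < 4 / 5 by norm_num)
    rw [inner_neg_right, norm_neg] at y1
    have y2 := mul_le_mul_of_nonneg_left y1 (mul_nonneg (sub_nonneg.2 hc1) hα.le)
    have y3 : 0 ≤ c * (α * ‖e‖ ^ 2) := by positivity
    rw [norm_add_sq_real, inner_add_right, real_inner_self_eq_norm_sq]
    linarith
  have b2 : 2 * β * ⟪h, T x⟫_ℝ ≤ c / 8 * D + c / 8 * D := by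
    have y1 := two_inner_le h (T x) (show 0 < c / 8 by positivity)
    have y2 := mul_le_mul_of_nonneg_left y1 hβ.le
    have y3 : β * (c / 8 * ‖h‖ ^ 2) ≤ c / 8 * D := by
      have := mul_le_mul_of_nonneg_left hh2 (show 0 ≤ c / 8 by positivity)
      linarith
    have y4 : β * ((c / 8)⁻¹ * ‖T x‖ ^ 2) ≤ c / 8 * D := by
      have e1 : β * ((c / 8)⁻¹ * ‖T x‖ ^ 2) = (64 * (β * ‖T x‖ ^ 2)) / (8 * c) := by
        field_simp; ring
      rw [e1, div_le_iff₀ (by positivity)]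
      have : c ^ 2 * X ≤ c ^ 2 * D := by gcongr
      linarith
    linarith
  have hαβσ : 512 * (α * β * σu) ≤ c := h5.trans (by
    calc c ^ 3 ≤ c ^ 1 := pow_le_pow_of_le_one hc.le hc1 (by norm_num)
      _ = c := pow_one c)
  have hSh : 512 * (α * β * ‖S h‖ ^ 2) ≤ c * ‖h‖ ^ 2 := by
    calc 512 * (α * β * ‖S h‖ ^ 2) ≤ 512 * (α * β * (σu * ‖h‖ ^ 2)) := by
          gcongr; exact hSu h
      _ = 512 * (α * β * σu) * ‖h‖ ^ 2 := by ring
      _ ≤ _ := by gcongr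
  have hShD : 512 * (α * β ^ 2 * ‖S h‖ ^ 2) ≤ c * D := by
    calc 512 * (α * β ^ 2 * ‖S h‖ ^ 2) = β * (512 * (α * β * ‖S h‖ ^ 2)) := by ring
      _ ≤ β * (c * ‖h‖ ^ 2) := by gcongr
      _ = c * (β * ‖h‖ ^ 2) := by ring
      _ ≤ _ := by gcongr
  have b3 : -(2 * α * β * ⟪S h, P + e⟫_ℝ) ≤
      1 / 10 * α * ‖P‖ ^ 2 + 26 / 512 * (c * D) + 3 / 128 * (c * D) := by
    have y1 := two_inner_le (-(β • S h)) P (show (0 : ℝ) < 10 by norm_num)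
    have y2 := two_inner_le (-(β • S h)) e (show (0 : ℝ) < 16 by norm_num)
    rw [inner_neg_left, inner_smul_left, norm_neg, norm_smul, Real.norm_of_nonneg hβ.le] at y1 y2
    have y3 := mul_le_mul_of_nonneg_left y1 hα.le
    have y4 := mul_le_mul_of_nonneg_left y2 hα.le
    simp only [conj_trivial] at y3 y4
    rw [inner_add_right]
    linarith
  have b4 : (1 - c) * σl * β * ‖x‖ ^ 2 ≤ c * D / 64 := by
    have : (1 - c) * σl * β * ‖x‖ ^ 2 ≤ 1 * σu * β * ‖x‖ ^ 2 := by gcongr; linarith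
    linarith
  -- This is the cross term of the form in the claimed decrease. Its sign is unknown, so it is
  -- charged to `‖P‖ ^ 2` and `D`.
  have b5 : (1 - c) * σl * (2 * α * β / c) * ⟪l, T x⟫_ℝ ≤
      1 / 10 * α * ‖P‖ ^ 2 + 10 / 512 / 64 * (c * D) := by
    set w := (1 - c) * (β / c) with hw
    have hw0 : 0 ≤ w := mul_nonneg (sub_nonneg.2 hc1) (by positivity)
    have hwβ : w ≤ β / c := by
      rw [hw]; exact mul_le_of_le_one_left (by positivity) (by linarith)
    have y1 := two_inner_le l (w • T x) (show (0 : ℝ) < 1 / 10 by norm_num)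
    rw [inner_smul_right, norm_smul, Real.norm_of_nonneg hw0] at y1
    have y2 := mul_le_mul_of_nonneg_left y1 (mul_pos hα hσl).le
    have y3 : α * (σl * ‖l‖ ^ 2) ≤ α * ‖P‖ ^ 2 := by gcongr; exact hSl l
    have y4 : α * σl * (w * ‖T x‖) ^ 2 ≤ 1 / 512 / 64 * (c * D) := by
      calc α * σl * (w * ‖T x‖) ^ 2 ≤ α * σu * (β / c * ‖T x‖) ^ 2 := by gcongr
        _ = (512 * (α * β * σu)) * (64 * (β * ‖T x‖ ^ 2)) / (512 * 64 * c ^ 2) := by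
          field_simp
        _ ≤ c ^ 3 * (c ^ 2 * X) / (512 * 64 * c ^ 2) := by gcongr
        _ = 1 / 512 / 64 * (c ^ 2 * (c * X)) := by field_simp
        _ ≤ 1 / 512 / 64 * (1 * (c * D)) := by
          gcongr
          exact pow_le_one₀ hc.le hc1
        _ = _ := by ring
    have e1 : (1 - c) * σl * (2 * α * β / c) * ⟪l, T x⟫_ℝ = α * σl * (2 * (w * ⟪l, T x⟫_ℝ)) := by
      rw [hw]; ring
    rw [e1]
    linarith
  have hPl : (1 - c) * (σl * (α * ‖l‖ ^ 2)) ≤ (1 - c) * (α * ‖P‖ ^ 2) := by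
    have := hSl l
    have h0 : 0 ≤ 1 - c := by linarith
    have : α * (σl * ‖l‖ ^ 2) ≤ α * ‖P‖ ^ 2 := by gcongr
    have := mul_le_mul_of_nonneg_left this h0
    linarith
  have hhc : c * β * ‖h‖ ^ 2 ≤ c * D := by
    have := mul_le_mul_of_nonneg_left hh2 hc.le
    linarith
  have hPα : 0 ≤ α * ‖P‖ ^ 2 := by positivity
  have hcPα : 0 ≤ c * (α * ‖P‖ ^ 2) := by positivity
  -- Budget: in units of `c * D` the costs are `15/32` (`he2` in `b1`), `1/4` (`b2`), `38/512`
  -- (`b3`), `1` (`hhc`), `1/64` (`b4`) and a negligible part of `b5`, below the available 2. In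
  -- units of `α * ‖P‖ ^ 2` the balance is `-4 * c / 5`.
  have hfin : -2 * c * D + c * α * ‖P + e‖ ^ 2 - 2 * α * ⟪P, P + e⟫_ℝ + 2 * β * ⟪h, T x⟫_ℝ
        - 2 * α * β * ⟪S h, P + e⟫_ℝ + c * β * ‖h‖ ^ 2 ≤
      -((1 - c) * σl * β * ‖x‖ ^ 2 + (1 - c) * (σl * (α * ‖l‖ ^ 2)) +
        (1 - c) * σl * (2 * α * β / c) * ⟪l, T x⟫_ℝ) := by
    linarith
  have hrhs : (1 - (1 - c) / c * α * β * σl) * metricForm T α β c x l =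
      metricForm T α β c x l - α * β * ((1 - c) * σl * β * ‖x‖ ^ 2 +
        (1 - c) * (σl * (α * ‖l‖ ^ 2)) + (1 - c) * σl * (2 * α * β / c) * ⟪l, T x⟫_ℝ) := by
    simp only [metricForm]
    field_simp
    ring
  rw [hg, hrhs]
  have := mul_le_mul_of_nonneg_left hfin (mul_pos hα hβ).le
  linarith

end Contraction

/-! ### ### Distance of a constant metric -/

section RiemannianDistance

variable {ι : Type*} [Fintype ι]

/-- The norm of the constant metric `M`. -/
noncomputable def metricNorm (M : Matrix ι ι ℝ) (v : EuclideanSpace ℝ ι) : ℝ :=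
  √(v.ofLp ⬝ᵥ M.mulVec v.ofLp)

theorem Matrix.PosSemidef.dotProduct_mulVec_self_nonneg {M : Matrix ι ι ℝ} (hM : M.PosSemidef)
    (v : ι → ℝ) : 0 ≤ v ⬝ᵥ M.mulVec v := by
  simpa using hM.dotProduct_mulVec_nonneg v

theorem Matrix.PosSemidef.dotProduct_mulVec_comm {M : Matrix ι ι ℝ} (hM : M.PosSemidef)
    (v w : ι → ℝ) : v ⬝ᵥ M.mulVec w = w ⬝ᵥ M.mulVec v := by
  have h : M.transpose = M := by simpa using hM.isHermitian.eq
  rw [Matrix.dotProduct_mulVec, ← Matrix.mulVec_transpose, h, dotProduct_comm]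

theorem Matrix.PosSemidef.dotProduct_mulVec_sq_le {M : Matrix ι ι ℝ} (hM : M.PosSemidef)
    (v w : ι → ℝ) :
    (v ⬝ᵥ M.mulVec w) ^ 2 ≤ (v ⬝ᵥ M.mulVec v) * (w ⬝ᵥ M.mulVec w) := by
  have h : ∀ t : ℝ, 0 ≤ (w ⬝ᵥ M.mulVec w) * (t * t) + (2 * (v ⬝ᵥ M.mulVec w)) * t +
      v ⬝ᵥ M.mulVec v := by
    intro t
    have h0 := hM.dotProduct_mulVec_self_nonneg (v + t • w)
    simp only [Matrix.mulVec_add, Matrix.mulVec_smul, dotProduct_add, add_dotProduct,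
      dotProduct_smul, smul_dotProduct, smul_eq_mul] at h0
    rw [hM.dotProduct_mulVec_comm w v] at h0
    linarith
  have := discrim_le_zero h
  rw [discrim] at this
  linarith

theorem Matrix.PosSemidef.dotProduct_mulVec_le {M : Matrix ι ι ℝ} (hM : M.PosSemidef)
    (v w : EuclideanSpace ℝ ι) :
    v.ofLp ⬝ᵥ M.mulVec w.ofLp ≤ metricNorm M v * metricNorm M w := by
  rw [metricNorm, metricNorm, ← Real.sqrt_mul (hM.dotProduct_mulVec_self_nonneg _)]
  exact Real.le_sqrt_of_sq_le (hM.dotProduct_mulVec_sq_le _ _)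

theorem continuous_metricNorm (M : Matrix ι ι ℝ) : Continuous (metricNorm M) := by
  unfold metricNorm
  fun_prop

theorem riemLength_nonneg (M : Matrix ι ι ℝ) (ϱ : ℝ → EuclideanSpace ℝ ι) :
    0 ≤ riemLength M ϱ :=
  intervalIntegral.integral_nonneg zero_le_one fun _ _ => Real.sqrt_nonneg _

/-- Pairing the path with a fixed `w` makes it scalar: the fundamental theorem of calculus applies,
and Cauchy–Schwarz for `M` bounds the integrand. Integrability is part of the conclusion so that the
pieces of a path can be added. -/
theorem metricNorm_le_integral_of_contDiffOn {M : Matrix ι ι ℝ} (hM : M.PosSemidef)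
    {ϱ : ℝ → EuclideanSpace ℝ ι} {a b : ℝ} (hab : a ≤ b)
    (hϱ : ContDiffOn ℝ ((⊤ : ℕ∞) : WithTop ℕ∞) ϱ (Set.Icc a b)) (w : EuclideanSpace ℝ ι) :
    IntervalIntegrable (fun s => metricNorm M (deriv ϱ s)) MeasureTheory.volume a b ∧
    w.ofLp ⬝ᵥ M.mulVec (ϱ b - ϱ a).ofLp ≤
      metricNorm M w * ∫ s in a..b, metricNorm M (deriv ϱ s) := by
  rcases hab.eq_or_lt with rfl | hlt
  · simp
  have hcont : ContinuousOn (fun s => derivWithin ϱ (Set.Icc a b) s) (Set.Icc a b) :=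
    hϱ.continuousOn_derivWithin (uniqueDiffOn_Icc hlt) (by simp)
  have heq : ∀ s ∈ Set.Ioo a b, derivWithin ϱ (Set.Icc a b) s = deriv ϱ s := fun s hs =>
    derivWithin_of_mem_nhds (Icc_mem_nhds hs.1 hs.2)
  have hder : ∀ s ∈ Set.Ioo a b, HasDerivAt ϱ (deriv ϱ s) s := fun s hs =>
    ((hϱ.differentiableOn (by simp) s ⟨hs.1.le, hs.2.le⟩).differentiableAt
      (Icc_mem_nhds hs.1 hs.2)).hasDerivAt
  have hint : ∀ g : EuclideanSpace ℝ ι → ℝ, Continuous g →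
      IntervalIntegrable (fun s => g (deriv ϱ s)) MeasureTheory.volume a b := by
    intro g hg
    -- `deriv` need not agree with the one-sided derivative at the endpoints, so integrability is
    -- transferred from the continuous `derivWithin`, equal to it off a null set.
    have h1 : IntervalIntegrable (fun s => g (derivWithin ϱ (Set.Icc a b) s))
        MeasureTheory.volume a b :=
      (hg.comp_continuousOn (by rwa [Set.uIcc_of_le hab])).intervalIntegrable
    refine h1.congr_ae ?_
    rw [Set.uIoc_of_le hab, ← MeasureTheory.restrict_Ioo_eq_restrict_Ioc]
    refine (MeasureTheory.ae_restrict_iff' measurableSet_Ioo).2 (Filter.Eventually.of_forall ?_)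
    intro s hs
    simp only [heq s hs]
  refine ⟨hint _ (continuous_metricNorm M), ?_⟩
  let φ : EuclideanSpace ℝ ι →ₗ[ℝ] ℝ :=
    { toFun := fun v => w.ofLp ⬝ᵥ M.mulVec v.ofLp
      map_add' := fun u v => by simp [Matrix.mulVec_add]
      map_smul' := fun t v => by simp [Matrix.mulVec_smul] }
  let φc := LinearMap.toContinuousLinearMap φ
  have hFTC : ∫ s in a..b, φc (deriv ϱ s) = φc (ϱ b) - φc (ϱ a) :=
    intervalIntegral.integral_eq_sub_of_hasDerivAt_of_le hab
      (φc.continuous.comp_continuousOn hϱ.continuousOn)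
      (fun s hs => φc.hasFDerivAt.comp_hasDerivAt s (hder s hs)) (hint _ φc.continuous)
  have e : w.ofLp ⬝ᵥ M.mulVec (ϱ b - ϱ a).ofLp = φc (ϱ b) - φc (ϱ a) := (map_sub φc _ _)
  rw [e, ← hFTC, ← intervalIntegral.integral_const_mul]
  exact intervalIntegral.integral_mono_on hab (hint _ φc.continuous)
    ((hint _ (continuous_metricNorm M)).const_mul _) fun s _ => hM.dotProduct_mulVec_le w _

/-- With the single choice `w = η - ξ` on every piece, the pairings telescope to the squared norm of
`η - ξ`; one factor of the norm is then cancelled. -/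
theorem metricNorm_le_riemLength {M : Matrix ι ι ℝ} (hM : M.PosSemidef)
    {ϱ : ℝ → EuclideanSpace ℝ ι} {ξ η : EuclideanSpace ℝ ι} (h : IsPiecewiseSmoothPath ϱ ξ η) :
    metricNorm M (η - ξ) ≤ riemLength M ϱ := by
  obtain ⟨h0, h1, m, t, ht, ht0, htm, hs⟩ := h
  have hp := fun i (hi : i < m) =>
    metricNorm_le_integral_of_contDiffOn hM (ht (Nat.le_succ i)) (hs i hi) (η - ξ)
  have hsum : ∑ i ∈ Finset.range m, ∫ s in t i..t (i + 1), metricNorm M (deriv ϱ s) =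
      riemLength M ϱ := by
    rw [intervalIntegral.sum_integral_adjacent_intervals fun i hi => (hp i hi).1, ht0, htm]
    rfl
  have htel : ∑ i ∈ Finset.range m, (ϱ (t (i + 1)) - ϱ (t i)) = η - ξ := by
    rw [Finset.sum_range_sub (fun i => ϱ (t i)), ht0, htm, h0, h1]
  have hle : (η - ξ).ofLp ⬝ᵥ M.mulVec (η - ξ).ofLp ≤ metricNorm M (η - ξ) * riemLength M ϱ := by
    have := Finset.sum_le_sum fun i hi => (hp i (Finset.mem_range.1 hi)).2
    rw [← Finset.mul_sum, hsum, ← dotProduct_sum, ← Matrix.mulVec_sum, ← WithLp.ofLp_sum,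
      htel] at this
    exact this
  rw [← Real.mul_self_sqrt (hM.dotProduct_mulVec_self_nonneg _)] at hle
  rcases (Real.sqrt_nonneg ((η - ξ).ofLp ⬝ᵥ M.mulVec (η - ξ).ofLp)).eq_or_lt with h | h
  · rw [metricNorm, ← h]; exact riemLength_nonneg M ϱ
  · exact le_of_mul_le_mul_left hle h

/-- The Riemannian distance of a constant metric is the norm of the difference: straight lines
are shortest. -/
theorem riemDist_eq_metricNorm {M : Matrix ι ι ℝ} (hM : M.PosSemidef)
    (ξ η : EuclideanSpace ℝ ι) : riemDist M ξ η = metricNorm M (η - ξ) := by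
  refine IsLeast.csInf_eq ⟨⟨fun s => ξ + s • (η - ξ), ⟨by simp, by simp, 1, fun i => i,
    Nat.mono_cast, by simp, by simp, fun i _ => ?_⟩, ?_⟩, ?_⟩
  · exact ContDiff.contDiffOn (by fun_prop)
  · have : deriv (fun s : ℝ => ξ + s • (η - ξ)) = fun _ => η - ξ := by
      funext s
      simpa using (((hasDerivAt_id s).smul_const (η - ξ)).const_add ξ).deriv
    rw [riemLength, this]
    simp [metricNorm]
  · rintro L ⟨ϱ, hϱ, rfl⟩
    exact metricNorm_le_riemLength hM hϱ

end RiemannianDistance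

/-! ### Gradients of the augmented Lagrangian -/

/-- Squaring smooths the kink: the first-order remainder is at most `(s - t) ^ 2` for all signs of
`s` and `t`. -/
theorem hasDerivAt_max_zero_sq (t : ℝ) :
    HasDerivAt (fun s : ℝ => max s 0 ^ 2) (2 * max t 0) t := by
  rw [hasDerivAt_iff_isLittleO]
  refine Asymptotics.IsBigO.trans_isLittleO (g := fun s => (s - t) ^ 2) ?_ ?_
  · refine Asymptotics.IsBigO.of_bound 1 (Filter.Eventually.of_forall fun s => ?_)
    rw [Real.norm_eq_abs, Real.norm_eq_abs, one_mul, abs_of_nonneg (sq_nonneg (s - t)), abs_le,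
      smul_eq_mul]
    rcases le_total s 0 with hs | hs <;> rcases le_total t 0 with ht | ht <;>
      simp only [hs, ht, max_eq_left, max_eq_right] <;> constructor <;>
      nlinarith [sq_nonneg (s - t)]
  · have h := (Asymptotics.isLittleO_pow_sub_sub t (show 1 < 2 by norm_num))
    simpa using h

/-- Completing the square merges both branches, so differentiability across the switching line needs
no case split. -/
theorem penalty_eq {γ : ℝ} (hγ : 0 < γ) (u l : ℝ) :
    penalty γ u l = (2 * γ)⁻¹ * (max (γ * u + l) 0 ^ 2 - l ^ 2) := by
  unfold penalty
  split_ifs with h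
  · rw [max_eq_left h]; field_simp; ring
  · rw [max_eq_right (not_le.1 h).le]; field_simp; ring

theorem hasDerivAt_penalty_left {γ : ℝ} (hγ : 0 < γ) (u l : ℝ) :
    HasDerivAt (fun v => penalty γ v l) (max (γ * u + l) 0) u := by
  simp only [penalty_eq hγ]
  have h1 : HasDerivAt (fun v : ℝ => γ * v + l) γ u := by
    simpa using ((hasDerivAt_id u).const_mul γ).add_const l
  have h2 := (((hasDerivAt_max_zero_sq (γ * u + l)).comp u h1).sub_const (l ^ 2)).const_mul
    (2 * γ)⁻¹
  exact h2.congr_deriv (by field_simp)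

theorem hasDerivAt_penalty_right {γ : ℝ} (hγ : 0 < γ) (u l : ℝ) :
    HasDerivAt (fun m => penalty γ u m) (1 / γ * (max (γ * u + l) 0 - l)) l := by
  simp only [penalty_eq hγ]
  have h1 : HasDerivAt (fun m : ℝ => γ * u + m) 1 l := (hasDerivAt_id l).const_add (γ * u)
  have h2 := (((hasDerivAt_max_zero_sq (γ * u + l)).comp l h1).sub (hasDerivAt_pow 2 l)).const_mul
    (2 * γ)⁻¹
  exact h2.congr_deriv (by field_simp; simp; ring)

section Iteration

variable {n p : ℕ} {f : EuclideanSpace ℝ (Fin n) → ℝ} {A : Matrix (Fin p) (Fin n) ℝ}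
  {b : Fin p → ℝ} {α β γ : ℝ}

theorem gradient_augLagrangian_left (hf : Differentiable ℝ f) (hγ : 0 < γ)
    (x : EuclideanSpace ℝ (Fin n)) (l : EuclideanSpace ℝ (Fin p)) :
    gradient (fun y => augLagrangian f A b γ y l) x =
      gradient f x +
        ∑ i, max (γ * (A.mulVec x.ofLp i - b i) + l i) 0 • WithLp.toLp 2 (A i) := by
  refine HasGradientAt.gradient ?_
  rw [hasGradientAt_iff_hasFDerivAt, map_add, map_sum]
  refine (hf x).hasGradientAt.hasFDerivAt.add (HasFDerivAt.fun_sum fun i _ => ?_)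
  have h1 : HasFDerivAt (fun y : EuclideanSpace ℝ (Fin n) => A.mulVec y.ofLp i - b i)
      (innerSL ℝ (WithLp.toLp 2 (A i) : EuclideanSpace ℝ (Fin n))) x := by
    have := (innerSL ℝ (WithLp.toLp 2 (A i) : EuclideanSpace ℝ (Fin n))).hasFDerivAt (x := x)
    refine (this.sub_const (b i)).congr_of_eventuallyEq (Filter.Eventually.of_forall fun y => ?_)
    simp [Matrix.mulVec, dotProduct, PiLp.inner_apply, mul_comm]
  refine ((hasDerivAt_penalty_left hγ _ (l i)).comp_hasFDerivAt x h1).congr_fderiv ?_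
  ext v
  simp

theorem gradient_augLagrangian_right (hγ : 0 < γ)
    (x : EuclideanSpace ℝ (Fin n)) (l : EuclideanSpace ℝ (Fin p)) :
    gradient (fun m => augLagrangian f A b γ x m) l =
      ∑ i, (1 / γ * (max (γ * (A.mulVec x.ofLp i - b i) + l i) 0 - l i)) •
        EuclideanSpace.single i (1 : ℝ) := by
  refine HasGradientAt.gradient ?_
  rw [hasGradientAt_iff_hasFDerivAt, map_sum]
  refine (HasFDerivAt.fun_sum fun i _ => ?_).const_add (f x)
  have h1 : HasFDerivAt (fun m : EuclideanSpace ℝ (Fin p) => m i)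
      (EuclideanSpace.proj (𝕜 := ℝ) i) l := (EuclideanSpace.proj (𝕜 := ℝ) i).hasFDerivAt
  refine ((hasDerivAt_penalty_right hγ _ (l i)).comp_hasFDerivAt l h1).congr_fderiv ?_
  ext v
  simp [EuclideanSpace.inner_single_left]

/-- Optimal pairs are fixed points of the iteration. -/
theorem IsKKTPair.primalStep_eq (hf : Differentiable ℝ f) (hγ : 0 < γ)
    {x : EuclideanSpace ℝ (Fin n)} {l : EuclideanSpace ℝ (Fin p)} (h : IsKKTPair f A b γ x l) :
    primalStep f A b α γ x l = x := by
  have h1 := h.1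
  rw [gradient_augLagrangian_left hf hγ] at h1
  rw [primalStep, sub_sub, ← smul_add, h1, smul_zero, sub_zero]

theorem IsKKTPair.dualStep_eq (hγ : 0 < γ)
    {x : EuclideanSpace ℝ (Fin n)} {l : EuclideanSpace ℝ (Fin p)} (h : IsKKTPair f A b γ x l) :
    dualStep A b β γ x l = l := by
  have h2 := h.2
  rw [gradient_augLagrangian_right hγ] at h2
  rw [dualStep, h2, smul_zero, add_zero]

/-! ### The constraint matrix and the metric -/

theorem inner_toEuclideanLin (x : EuclideanSpace ℝ (Fin n)) (l : EuclideanSpace ℝ (Fin p)) :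
    ⟪l, A.toEuclideanLin x⟫_ℝ = ⟪A.transpose.toEuclideanLin l, x⟫_ℝ := by
  simp only [EuclideanSpace.inner_eq_star_dotProduct, Matrix.toLpLin_apply, star_trivial]
  rw [dotProduct_comm, Matrix.dotProduct_mulVec, ← Matrix.mulVec_transpose, dotProduct_comm]

theorem norm_toEuclideanLin_transpose_sq (l : EuclideanSpace ℝ (Fin p)) :
    ‖A.transpose.toEuclideanLin l‖ ^ 2 = l.ofLp ⬝ᵥ (A * A.transpose).mulVec l.ofLp := by
  rw [← real_inner_self_eq_norm_sq, ← inner_toEuclideanLin]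
  simp only [EuclideanSpace.inner_eq_star_dotProduct, Matrix.toLpLin_apply, star_trivial,
    Matrix.mulVec_mulVec]
  rw [dotProduct_comm]

theorem dotProduct_self_eq_norm_sq {ι : Type*} [Fintype ι] (l : EuclideanSpace ℝ ι) :
    l.ofLp ⬝ᵥ l.ofLp = ‖l‖ ^ 2 := by
  rw [← real_inner_self_eq_norm_sq, EuclideanSpace.inner_eq_star_dotProduct, star_trivial]

theorem IsRowBounded.le_norm_sq {σl σu : ℝ} (hA : IsRowBounded A σl σu)
    (l : EuclideanSpace ℝ (Fin p)) : σl * ‖l‖ ^ 2 ≤ ‖A.transpose.toEuclideanLin l‖ ^ 2 := by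
  have := hA.lower.dotProduct_mulVec_self_nonneg l.ofLp
  rw [Matrix.sub_mulVec, dotProduct_sub, Matrix.smul_mulVec, Matrix.one_mulVec, dotProduct_smul,
    dotProduct_self_eq_norm_sq, smul_eq_mul, ← norm_toEuclideanLin_transpose_sq] at this
  linarith

theorem IsRowBounded.norm_sq_le {σl σu : ℝ} (hA : IsRowBounded A σl σu)
    (l : EuclideanSpace ℝ (Fin p)) : ‖A.transpose.toEuclideanLin l‖ ^ 2 ≤ σu * ‖l‖ ^ 2 := by
  have := hA.upper.dotProduct_mulVec_self_nonneg l.ofLp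
  rw [Matrix.sub_mulVec, dotProduct_sub, Matrix.smul_mulVec, Matrix.one_mulVec, dotProduct_smul,
    dotProduct_self_eq_norm_sq, smul_eq_mul, ← norm_toEuclideanLin_transpose_sq] at this
  linarith

theorem stack_dotProduct_metricM_mulVec (α β c : ℝ) (x : EuclideanSpace ℝ (Fin n))
    (l : EuclideanSpace ℝ (Fin p)) :
    (stack x l).ofLp ⬝ᵥ (metricM A α β c).mulVec (stack x l).ofLp =
      metricForm A.toEuclideanLin α β c x l := by
  have h1 : x.ofLp ⬝ᵥ A.transpose.mulVec l.ofLp = l.ofLp ⬝ᵥ A.mulVec x.ofLp := by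
    rw [Matrix.dotProduct_mulVec, Matrix.vecMul_transpose, dotProduct_comm]
  have h2 : ⟪l, A.toEuclideanLin x⟫_ℝ = l.ofLp ⬝ᵥ A.mulVec x.ofLp := by
    simp only [EuclideanSpace.inner_eq_star_dotProduct, Matrix.toLpLin_apply, star_trivial]
    rw [dotProduct_comm]
  simp only [stack, metricM, metricForm, Matrix.fromBlocks_mulVec, Sum.elim_comp_inl, Sum.elim_comp_inr,
    sumElim_dotProduct_sumElim,
    dotProduct_add, Matrix.smul_mulVec, Matrix.one_mulVec, dotProduct_smul, smul_eq_mul, h1,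
    ← h2, dotProduct_self_eq_norm_sq]
  ring

theorem stack_sub_stack (x y : EuclideanSpace ℝ (Fin n)) (l m : EuclideanSpace ℝ (Fin p)) :
    stack y m - stack x l = stack (y - x) (m - l) := by
  ext i
  rcases i with i | i <;> simp [stack]

theorem exists_eq_stack (v : EuclideanSpace ℝ (Fin n ⊕ Fin p)) :
    ∃ x l, v = stack x l :=
  ⟨WithLp.toLp 2 fun i => v (.inl i), WithLp.toLp 2 fun i => v (.inr i), by
    ext i; rcases i with i | i <;> simp [stack]⟩

/-- The off-diagonal part of the metric is at most half of the diagonal part. -/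
theorem abs_inner_le_of_isRowBounded {σl σu c : ℝ} (hA : IsRowBounded A σl σu)
    (hα : 0 < α) (hβ : 0 < β) (hc : 0 < c) (h : 4 * (α * β * σu) ≤ c ^ 2)
    (x : EuclideanSpace ℝ (Fin n)) (l : EuclideanSpace ℝ (Fin p)) :
    |2 * (α * β) * ⟪l, A.toEuclideanLin x⟫_ℝ| ≤
      c / 2 * (β * ‖x‖ ^ 2 + α * ‖l‖ ^ 2) := by
  rw [inner_toEuclideanLin, abs_mul, abs_of_pos (by positivity)]
  have h1 := abs_real_inner_le_norm (A.transpose.toEuclideanLin l) x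
  set P := A.transpose.toEuclideanLin l
  have h2 := hA.norm_sq_le l
  have h3 : 2 * (α * β) * (‖P‖ * ‖x‖) ≤ 2 * α ^ 2 * β / c * ‖P‖ ^ 2 + c / 2 * (β * ‖x‖ ^ 2) := by
    have : 0 ≤ β / (2 * c) * (2 * α * ‖P‖ - c * ‖x‖) ^ 2 := by positivity
    have e : β / (2 * c) * (2 * α * ‖P‖ - c * ‖x‖) ^ 2 =
      2 * α ^ 2 * β / c * ‖P‖ ^ 2 + c / 2 * (β * ‖x‖ ^ 2) - 2 * (α * β) * (‖P‖ * ‖x‖) := by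
      field_simp; ring
    linarith
  have h4 : 2 * α ^ 2 * β / c * ‖P‖ ^ 2 ≤ c / 2 * (α * ‖l‖ ^ 2) := by
    calc 2 * α ^ 2 * β / c * ‖P‖ ^ 2 ≤ 2 * α ^ 2 * β / c * (σu * ‖l‖ ^ 2) := by gcongr
      _ = (4 * (α * β * σu)) * (α * ‖l‖ ^ 2) / (2 * c) := by field_simp; ring
      _ ≤ c ^ 2 * (α * ‖l‖ ^ 2) / (2 * c) := by gcongr
      _ = _ := by field_simp
  have h5 : 2 * (α * β) * |⟪P, x⟫_ℝ| ≤ 2 * (α * β) * (‖P‖ * ‖x‖) := by gcongr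
  linarith

theorem le_metricForm {σl σu c : ℝ} (hA : IsRowBounded A σl σu)
    (hα : 0 < α) (hβ : 0 < β) (hc : 0 < c) (h : 4 * (α * β * σu) ≤ c ^ 2)
    (x : EuclideanSpace ℝ (Fin n)) (l : EuclideanSpace ℝ (Fin p)) :
    c / 2 * (β * ‖x‖ ^ 2 + α * ‖l‖ ^ 2) ≤ metricForm A.toEuclideanLin α β c x l := by
  have := (abs_le.1 (abs_inner_le_of_isRowBounded hA hα hβ hc h x l)).1
  unfold metricForm
  linarith

theorem metricForm_le {σl σu c : ℝ} (hA : IsRowBounded A σl σu)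
    (hα : 0 < α) (hβ : 0 < β) (hc : 0 < c) (h : 4 * (α * β * σu) ≤ c ^ 2)
    (x : EuclideanSpace ℝ (Fin n)) (l : EuclideanSpace ℝ (Fin p)) :
    metricForm A.toEuclideanLin α β c x l ≤ 3 * c / 2 * (β * ‖x‖ ^ 2 + α * ‖l‖ ^ 2) := by
  have := (abs_le.1 (abs_inner_le_of_isRowBounded hA hα hβ hc h x l)).2
  unfold metricForm
  linarith

theorem posDef_metricM {σl σu c : ℝ} (hA : IsRowBounded A σl σu)
    (hα : 0 < α) (hβ : 0 < β) (hc : 0 < c) (h : 4 * (α * β * σu) ≤ c ^ 2) :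
    (metricM A α β c).PosDef := by
  rw [Matrix.posDef_iff_dotProduct_mulVec]
  refine ⟨?_, fun {v} hv => ?_⟩
  · rw [Matrix.IsHermitian, metricM, Matrix.fromBlocks_conjTranspose]
    simp
  · obtain ⟨x, l, hxl⟩ := exists_eq_stack (WithLp.toLp 2 v)
    have hvs : v = (stack x l).ofLp := by rw [← hxl]
    rw [star_trivial, hvs, stack_dotProduct_metricM_mulVec]
    refine lt_of_lt_of_le ?_ (le_metricForm hA hα hβ hc h x l)
    have hne : x ≠ 0 ∨ l ≠ 0 := by
      by_contra! h0
      apply hv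
      rw [hvs, h0.1, h0.2]
      ext i
      rcases i with i | i <;> simp [stack]
    rcases hne with h0 | h0
    · have := norm_pos_iff.2 h0
      positivity
    · have := norm_pos_iff.2 h0
      positivity

theorem riemDist_stack {c : ℝ} (hM : (metricM A α β c).PosDef)
    (x y : EuclideanSpace ℝ (Fin n)) (l m : EuclideanSpace ℝ (Fin p)) :
    riemDist (metricM A α β c) (stack x l) (stack y m) =
      √(metricForm A.toEuclideanLin α β c (y - x) (m - l)) := by
  rw [riemDist_eq_metricNorm hM.posSemidef, stack_sub_stack, metricNorm,
    stack_dotProduct_metricM_mulVec]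

/-! ### One step of the iteration -/

/-- A mean value form for the nonsmooth `max · 0`, monotone and 1-Lipschitz: `δ` is the difference
quotient, or 0 when `s = t`. -/
theorem exists_max_zero_sub_eq (s t : ℝ) :
    ∃ δ, 0 ≤ δ ∧ δ ≤ 1 ∧ max s 0 - max t 0 = δ * (s - t) := by
  rcases eq_or_ne s t with rfl | hst
  · exact ⟨0, le_rfl, zero_le_one, by simp⟩
  have hne := sub_ne_zero.2 hst
  refine ⟨(max s 0 - max t 0) / (s - t), ?_, ?_, by field_simp⟩
  · rcases hne.lt_or_gt with h | h
    · refine div_nonneg_of_nonpos ?_ h.le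
      have := max_le_max_right 0 (sub_neg.1 h).le
      linarith
    · refine div_nonneg ?_ h.le
      have := max_le_max_right 0 (sub_pos.1 h).le
      linarith
  · refine (le_abs_self _).trans ?_
    rw [abs_div]
    exact div_le_one_of_le₀ (abs_max_sub_max_le_abs s t 0) (abs_nonneg _)

theorem sum_smul_row_eq (v : Fin p → ℝ) :
    ∑ i, v i • (WithLp.toLp 2 (A i) : EuclideanSpace ℝ (Fin n)) =
      A.transpose.toEuclideanLin (WithLp.toLp 2 v) := by
  ext j
  simp [Matrix.toLpLin_apply, Matrix.mulVec, dotProduct, mul_comm]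

theorem dualStep_apply (x : EuclideanSpace ℝ (Fin n)) (l : EuclideanSpace ℝ (Fin p)) (i : Fin p) :
    dualStep A b β γ x l i =
      l i + β * (1 / γ * (max (γ * (A.mulVec x.ofLp i - b i) + l i) 0 - l i)) := by
  simp [dualStep, Finset.sum_apply, Pi.single_apply]

/-- Reduction to `metricForm_step_le`, with `Δ` the diagonal matrix of the `δ i`. The bounds on `r`
and `q` are `δ i ^ 2 ≤ δ i` and its analogue for `1 - δ i`, coordinatewise. -/
theorem riemDist_step_le {ρl ρu σl σu c : ℝ}
    (hρl : 0 < ρl) (hρ : ρl ≤ ρu) (hσl : 0 < σl) (hσ : σl ≤ σu)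
    (hα : 0 < α) (hβ : 0 < β) (hγ : 0 < γ) (hγβ : 2 * β ≤ γ) (hc : 0 < c) (hc1 : c ≤ 1)
    (h1 : 8 * (α * ρu) ≤ c) (h2 : 8 * (α * γ * σu) ≤ c)
    (h4 : 64 * (β * σu) ≤ c ^ 2 * ρl) (h5 : 512 * (α * β * σu) ≤ c ^ 3)
    (hf : IsStronglyConvexSmooth f ρl ρu) (hA : IsRowBounded A σl σu)
    (hM : (metricM A α β c).PosDef)
    (hτ : 0 ≤ 1 - (1 - c) / c * α * β * σl)
    (x y : EuclideanSpace ℝ (Fin n)) (l m : EuclideanSpace ℝ (Fin p)) :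
    riemDist (metricM A α β c)
        (stack (primalStep f A b α γ x l) (dualStep A b β γ x l))
        (stack (primalStep f A b α γ y m) (dualStep A b β γ y m)) ≤
      rateIEC σl α β c * riemDist (metricM A α β c) (stack x l) (stack y m) := by
  rw [riemDist_stack hM, riemDist_stack hM, rateIEC, ← Real.sqrt_mul hτ]
  apply Real.sqrt_le_sqrt
  choose δ hδ0 hδ1 hδ using fun i => exists_max_zero_sub_eq
    (γ * (A.mulVec y.ofLp i - b i) + m i) (γ * (A.mulVec x.ofLp i - b i) + l i)
  let T := A.toEuclideanLin
  let S := A.transpose.toEuclideanLin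
  let r : EuclideanSpace ℝ (Fin p) := WithLp.toLp 2 fun i => δ i * T (y - x) i
  let q : EuclideanSpace ℝ (Fin p) := WithLp.toLp 2 fun i => (1 - δ i) * (m - l) i
  have hT : ∀ i, T (y - x) i = A.mulVec y.ofLp i - A.mulVec x.ofLp i := fun i => by
    simp [T, Matrix.toLpLin_apply, Matrix.mulVec_sub]
  have hmax : ∀ i, max (γ * (A.mulVec y.ofLp i - b i) + m i) 0 -
      max (γ * (A.mulVec x.ofLp i - b i) + l i) 0 = (γ • r + (m - l) - q) i := fun i => by
    rw [hδ]
    simp only [r, q, hT, PiLp.add_apply, PiLp.sub_apply, PiLp.smul_apply, smul_eq_mul]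
    ring
  have hprimal : primalStep f A b α γ y m - primalStep f A b α γ x l =
      (y - x) - α • ((gradient f y - gradient f x) + S (γ • r + (m - l) - q)) := by
    have e : γ • r + (m - l) - q =
        WithLp.toLp 2 (fun i => max (γ * (A.mulVec y.ofLp i - b i) + m i) 0) -
        WithLp.toLp 2 (fun i => max (γ * (A.mulVec x.ofLp i - b i) + l i) 0) := by
      ext i; rw [← hmax]; simp
    rw [e, map_sub, primalStep, primalStep, sum_smul_row_eq, sum_smul_row_eq]
    module
  have hdual : dualStep A b β γ y m - dualStep A b β γ x l =
      (m - l) + β • (r - γ⁻¹ • q) := by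
    ext i
    have h := hmax i
    simp only [PiLp.add_apply, PiLp.sub_apply, PiLp.smul_apply, smul_eq_mul, dualStep_apply] at h ⊢
    have e : max (γ * (A.mulVec y.ofLp i - b i) + m i) 0 =
      max (γ * (A.mulVec x.ofLp i - b i) + l i) 0 + (γ * r i + (m i - l i) - q i) := by linarith
    rw [e]
    field_simp
    ring
  rw [hprimal, hdual]
  have hin : ∀ u v : EuclideanSpace ℝ (Fin p), ⟪u, v⟫_ℝ = ∑ i, u i * v i := fun u v => by
    simp [PiLp.inner_apply, mul_comm]
  refine metricForm_step_le hρl hρ hσl hσ hα hβ hγ hγβ hc hc1 h1 h2 h4 h5 inner_toEuclideanLin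
    hA.le_norm_sq hA.norm_sq_le (y - x) (gradient f y - gradient f x) (m - l) r q
    (hf.strong y x) (hf.cocoercive hρl (hρl.trans_le hρ) y x) ?_ ?_ ?_
  · rw [← real_inner_self_eq_norm_sq, hin, hin]
    refine Finset.sum_le_sum fun i _ => ?_
    change δ i * T (y - x) i * (δ i * T (y - x) i) ≤ δ i * T (y - x) i * T (y - x) i
    have : 0 ≤ δ i * (1 - δ i) * (T (y - x) i) ^ 2 :=
      mul_nonneg (mul_nonneg (hδ0 i) (sub_nonneg.2 (hδ1 i))) (sq_nonneg _)
    linarith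
  · rw [← real_inner_self_eq_norm_sq, hin, hin]
    refine Finset.sum_le_sum fun i _ => ?_
    change (1 - δ i) * (m - l) i * ((1 - δ i) * (m - l) i) ≤ (1 - δ i) * (m - l) i * (m - l) i
    have : 0 ≤ δ i * (1 - δ i) * ((m - l) i) ^ 2 :=
      mul_nonneg (mul_nonneg (hδ0 i) (sub_nonneg.2 (hδ1 i))) (sq_nonneg _)
    linarith
  · rw [hin, hin, hin, ← Finset.sum_sub_distrib]
    refine Finset.sum_congr rfl fun i _ => ?_
    change δ i * T (y - x) i * (m - l) i =
      (m - l) i * T (y - x) i - (1 - δ i) * (m - l) i * T (y - x) i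
    ring

end Iteration

/-! ### The scalar constants -/

/-- The smallness conditions on the step sizes that the definition of `c` encodes. -/
theorem constMax_bounds {ρl ρu σl σu α β γ c : ℝ}
    (hρl : 0 < ρl) (hρ : ρl ≤ ρu) (hσl : 0 < σl) (hσ : σl ≤ σu)
    (hα : 0 < α) (hβ : 0 < β) (hγ : 0 < γ)
    (hc : c = 4 * constMax ρl ρu σl σu α β γ) :
    0 < c ∧ 8 * (α * ρu) ≤ c ∧ 8 * (α * γ * σu) ≤ c ∧ 64 * (β * σu) ≤ c ^ 2 * ρl ∧
      512 * (α * β * σu) ≤ c ^ 3 := by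
  have hσu : 0 < σu := hσl.trans_le hσ
  have hρu : 0 < ρu := hρl.trans_le hρ
  have hc1 : const1 ρu σl σu α γ ≤ c / 4 := by
    rw [hc, mul_div_cancel_left₀ _ four_ne_zero]
    exact (le_max_left _ _).trans (le_max_left _ _)
  have hc3 : const3 ρl σl σu α β γ ≤ c / 4 := by
    rw [hc, mul_div_cancel_left₀ _ four_ne_zero]
    exact (le_max_left _ _).trans (le_max_right _ _)
  have h1 : 8 * (α * ρu) ≤ c := by
    have : α * ρu * 2 ≤ const1 ρu σl σu α γ := by
      unfold const1
      gcongr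
      · exact le_max_left _ _
      · exact le_max_left _ _
    linarith
  have h2 : 8 * (α * γ * σu) ≤ c := by
    have : α * γ * σu * 2 ≤ const1 ρu σl σu α γ := by
      unfold const1
      gcongr
      · exact le_max_right _ _
      · exact le_max_left _ _
    linarith
  have hc0 : 0 < c := lt_of_lt_of_le (by positivity) h1
  have h3 : 64 * (β * σu) ≤ c ^ 2 * ρl := by
    -- This entry of `const3` gives `8 * β * σu ≤ c * ρl * (α * γ * σl)`; bounding `α * γ * σl` by
    -- `c / 8` through `const1` yields the second factor `c`.
    have h : β * σu / ρl * (2 / (α * γ * σl)) ≤ const3 ρl σl σu α β γ := by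
      unfold const3
      gcongr
      exact (le_max_left _ _).trans (le_max_right _ _)
    have h' := h.trans hc3
    rw [div_mul_div_comm, div_le_iff₀ (by positivity)] at h'
    have h4 : c / 4 * (ρl * (α * γ * σl)) ≤ c / 4 * (ρl * (c / 8)) := by
      have : α * γ * σl ≤ α * γ * σu := by gcongr
      gcongr
      linarith
    linarith
  refine ⟨hc0, h1, h2, h3, ?_⟩
  calc 512 * (α * β * σu) = 8 * α * (64 * (β * σu)) := by ring
    _ ≤ 8 * α * (c ^ 2 * ρl) := by gcongr
    _ = c ^ 2 * (8 * (α * ρl)) := by ring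
    _ ≤ c ^ 2 * (8 * (α * ρu)) := by gcongr
    _ ≤ c ^ 2 * c := by gcongr
    _ = c ^ 3 := by ring

/-- The factor 3 is the ratio of the bounds `3 * c / 2` and `c / 2` on `metricForm`. The statement
is symmetric under exchanging the two variables together with `α` and `β`, so it serves both
components. -/
theorem le_of_sq_norm_le {α β c t u v s w : ℝ} (hα : 0 < α) (hβ : 0 < β) (hc : 0 < c)
    (ht : 0 ≤ t) (hs : 0 ≤ s) (hw : 0 ≤ w)
    (h : c / 2 * (β * u ^ 2 + α * v ^ 2) ≤ t ^ 2 * (3 * c / 2 * (β * s ^ 2 + α * w ^ 2))) :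
    u ≤ √(3 * (α + β) / β) * t * (s + w) := by
  have h1 : β * u ^ 2 ≤ t ^ 2 * (3 * (α + β)) * (s + w) ^ 2 := by
    have h2 : c / 2 * (β * u ^ 2) ≤ c / 2 * (t ^ 2 * (3 * (α + β)) * (s + w) ^ 2) := by
      have h3 : β * s ^ 2 + α * w ^ 2 ≤ (α + β) * (s + w) ^ 2 := by
        have : 0 ≤ α * s ^ 2 + β * w ^ 2 + 2 * (α + β) * (s * w) := by positivity
        linarith
      have h4 : t ^ 2 * (3 * c / 2 * (β * s ^ 2 + α * w ^ 2)) ≤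
        t ^ 2 * (3 * c / 2 * ((α + β) * (s + w) ^ 2)) := by gcongr
      have h5 : 0 ≤ c / 2 * (α * v ^ 2) := by positivity
      linarith
    exact le_of_mul_le_mul_left h2 (by positivity)
  refine le_of_sq_le_sq ?_ (by positivity)
  rw [mul_pow, mul_pow, Real.sq_sqrt (by positivity), div_mul_eq_mul_div, div_mul_eq_mul_div,
    le_div_iff₀ hβ]
  linarith

/-! ### ### The convergence theorem -/

theorem theorem2
    (ρl ρu σl σu α β γ c τ : ℝ)
    (hρl : 0 < ρl) (hρ : ρl ≤ ρu) (hσl : 0 < σl) (hσ : σl ≤ σu)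
    (hα : 0 < α) (hβ : 0 < β) (hγ : 0 < γ) (hγβ : 2 * β ≤ γ)
    (hmax : constMax ρl ρu σl σu α β γ ∈ Set.Icc (0 : ℝ) (1 / 4))
    (hc : c = 4 * constMax ρl ρu σl σu α β γ)
    (hτ : τ = rateIEC σl α β c) :
    -- the rate is meaningful, and it is a strict contraction rate unless `c = 1`
    (0 < c ∧ 0 < τ ∧ τ ≤ 1 ∧ (c < 1 → τ < 1)) ∧
    -- the constants depend on the scalar parameters only
    ∃ C₁ C₂ : ℝ, 0 < C₁ ∧ 0 < C₂ ∧
      ∀ (n p : ℕ) (f : EuclideanSpace ℝ (Fin n) → ℝ)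
        (A : Matrix (Fin p) (Fin n) ℝ) (b : Fin p → ℝ),
        IsStronglyConvexSmooth f ρl ρu → IsRowBounded A σl σu →
        (metricM A α β c).PosDef ∧
        -- one step of the iteration contracts the distance of any two states
        (∀ (x y : EuclideanSpace ℝ (Fin n)) (l m : EuclideanSpace ℝ (Fin p)),
          riemDist (metricM A α β c)
              (stack (primalStep f A b α γ x l) (dualStep A b β γ x l))
              (stack (primalStep f A b α γ y m) (dualStep A b β γ y m))
            ≤ τ * riemDist (metricM A α β c) (stack x l) (stack y m)) ∧
        -- geometric convergence of every trajectory to every optimal pair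
        (∀ (x : ℕ → EuclideanSpace ℝ (Fin n)) (l : ℕ → EuclideanSpace ℝ (Fin p))
          (xs : EuclideanSpace ℝ (Fin n)) (ls : EuclideanSpace ℝ (Fin p)),
          (∀ k, x (k + 1) = primalStep f A b α γ (x k) (l k)) →
          (∀ k, l (k + 1) = dualStep A b β γ (x k) (l k)) →
          IsKKTPair f A b γ xs ls →
          ∀ k : ℕ,
            riemDist (metricM A α β c) (stack (x k) (l k)) (stack xs ls)
              ≤ τ ^ k * riemDist (metricM A α β c) (stack (x 0) (l 0)) (stack xs ls) ∧
            dist (x k) xs ≤ C₁ * τ ^ k * (dist (x 0) xs + dist (l 0) ls) ∧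
            dist (l k) ls ≤ C₂ * τ ^ k * (dist (x 0) xs + dist (l 0) ls)) := by
  obtain ⟨hc0, h1, h2, h3, h4⟩ := constMax_bounds hρl hρ hσl hσ hα hβ hγ hc
  have hc1 : c ≤ 1 := by have := hmax.2; linarith
  have hσu : 0 < σu := hσl.trans_le hσ
  have hpow : c ^ 3 ≤ c ^ 2 := pow_le_pow_of_le_one hc0.le hc1 (by norm_num)
  have h4' : 4 * (α * β * σu) ≤ c ^ 2 := by
    have : 0 < α * β * σu := by positivity
    linarith
  have hsmall : (1 - c) / c * α * β * σl < 1 := by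
    have e : (1 - c) / c * α * β * σl = (1 - c) * (α * β * σl) / c := by ring
    rw [e, div_lt_one hc0]
    have k1 : (1 - c) * (α * β * σl) ≤ 1 * (α * β * σu) := by gcongr; linarith
    have k2 : c ^ 2 ≤ c := by nlinarith
    linarith
  have hnn : 0 ≤ (1 - c) / c * α * β * σl := by
    have : 0 ≤ 1 - c := by linarith
    positivity
  have hτ0 : 0 < τ := by rw [hτ]; exact Real.sqrt_pos.2 (by linarith)
  refine ⟨⟨hc0, hτ0, ?_, fun hlt => ?_⟩, √(3 * (α + β) / β), √(3 * (β + α) / α),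
    Real.sqrt_pos.2 (by positivity), Real.sqrt_pos.2 (by positivity),
    fun n p f A b hf hA => ?_⟩
  · rw [hτ]; exact Real.sqrt_le_one.2 (by linarith)
  · have : 0 < (1 - c) / c * α * β * σl := by
      have : 0 < 1 - c := by linarith
      positivity
    rw [hτ, rateIEC, Real.sqrt_lt' one_pos]
    linarith
  have hM := posDef_metricM hA hα hβ hc0 h4'
  have hstep : ∀ (x y : EuclideanSpace ℝ (Fin n)) (l m : EuclideanSpace ℝ (Fin p)),
      riemDist (metricM A α β c)
          (stack (primalStep f A b α γ x l) (dualStep A b β γ x l))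
          (stack (primalStep f A b α γ y m) (dualStep A b β γ y m))
        ≤ τ * riemDist (metricM A α β c) (stack x l) (stack y m) := fun x y l m => by
    rw [hτ]
    exact riemDist_step_le hρl hρ hσl hσ hα hβ hγ hγβ hc0 hc1 h1 h2 h3 h4 hf hA hM
      (by linarith) x y l m
  refine ⟨hM, hstep, fun x l xs ls hx hl hK k => ?_⟩
  have hdist : riemDist (metricM A α β c) (stack (x k) (l k)) (stack xs ls)
      ≤ τ ^ k * riemDist (metricM A α β c) (stack (x 0) (l 0)) (stack xs ls) := by
    induction k with
    | zero => simp
    | succ k ih =>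
      -- The optimal pair is a fixed point, so the contraction compares the trajectory with a
      -- constant one.
      have h := hstep (x k) xs (l k) ls
      rw [hK.primalStep_eq hf.differentiable hγ, hK.dualStep_eq hγ, ← hx, ← hl] at h
      calc _ ≤ τ * riemDist (metricM A α β c) (stack (x k) (l k)) (stack xs ls) := h
        _ ≤ τ * (τ ^ k * riemDist (metricM A α β c) (stack (x 0) (l 0)) (stack xs ls)) := by
          gcongr
        _ = _ := by ring
  have hform : ∀ j, 0 ≤ metricForm A.toEuclideanLin α β c (xs - x j) (ls - l j) := fun j =>
    le_trans (by positivity) (le_metricForm hA hα hβ hc0 h4' (xs - x j) (ls - l j))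
  have hsq : metricForm A.toEuclideanLin α β c (xs - x k) (ls - l k) ≤
      (τ ^ k) ^ 2 * metricForm A.toEuclideanLin α β c (xs - x 0) (ls - l 0) := by
    have h := hdist
    rw [riemDist_stack hM, riemDist_stack hM] at h
    have h' := pow_le_pow_left₀ (Real.sqrt_nonneg _) h 2
    rwa [mul_pow, Real.sq_sqrt (hform k), Real.sq_sqrt (hform 0)] at h'
  have hfin := (le_metricForm hA hα hβ hc0 h4' (xs - x k) (ls - l k)).trans (hsq.trans
    (mul_le_mul_of_nonneg_left (metricForm_le hA hα hβ hc0 h4' (xs - x 0) (ls - l 0))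
      (sq_nonneg _)))
  rw [← dist_eq_norm, ← dist_eq_norm, ← dist_eq_norm, ← dist_eq_norm, dist_comm xs, dist_comm xs,
    dist_comm ls, dist_comm ls] at hfin
  refine ⟨hdist, le_of_sq_norm_le hα hβ hc0 (by positivity) dist_nonneg dist_nonneg hfin, ?_⟩
  rw [add_comm (dist (x 0) xs)]
  exact le_of_sq_norm_le (v := dist (x k) xs) hβ hα hc0 (by positivity) dist_nonneg dist_nonneg
    (by linarith)
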